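/- Let $\mathbb{R}_d$ be the additive group $\mathbb{R}$ with the discrete topology. For a topological abelian group $G$ and a Banach space $X$, a continuous $f:G\to X$ is recurrent, $f\in REC(G,X)$, if for every compact $K\subset G$ and every $\varepsilon>0$ there is a compact $L\subset G$ with $\{\tau\in G:\|f(t+\tau)-f(t)\|\le\varepsilon\ \text{for all } t\in K\}+L=G$. A continuous $f:G\to X$ is minimal, $f\in MIN(G,X)$, if the closure $O(f)$ of its set of translates in $C(G,X)$, with the topology of uniform convergence on compact sets, has no nonempty closed translation-invariant subset other than $O(f)$ itself. For $f:\mathbb{R}\to X$ put $\Delta_hf(t)=f(t+h)-f(t)$ and, if $f\in L^1_{loc}(\mathbb{R},X)$, $Pf(t)=\int_0^tf(s)\,ds$ and $M_hf(t)=\frac1h\int_0^hf(t+s)\,ds$. For classes $\mathcal{A},U\subset X^{\mathbb{R}}$: - $\mathcal{A}$ satisfies $(L_U)$ if $F\in U$ and $\Delta_hF\in\mathcal{A}$ for all $h>0$ imply $F\in\mathcal{A}$; - $\mathcal{A}$ satisfies $(P_U)$ if $f\in\mathcal{A}\cap L^1_{loc}(\mathbb{R},X)$ and $Pf\in U$ imply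 $Pf\in\mathcal{A}$; - $\mathcal{MA}=\{f\in L^1_{loc}(\mathbb{R},X): M_hf\in\mathcal{A}\text{ for all }h>0\}$. Let $C_b(\mathbb{R},X)$ be the set of bounded continuous functions, write $(P_b)$ and $(L_b)$ for $(P_U)$ and $(L_U)$ with $U=C_b(\mathbb{R},X)$, and let $C_{b,wscp}(\mathbb{R},X)$ be the set of $f\in C_b(\mathbb{R},X)$ such that every weakly Cauchy sequence in $f(\mathbb{R})$ converges weakly to an element of $X$. Finally let $\mathcal{A}(X)=REC(\mathbb{R}_d,X)\cap C(\mathbb{R},X)$ and $\mathcal{A}_b(X)=\mathcal{A}(X)\cap C_b(\mathbb{R},X)$. **(a)** Let $X$ be a real or complex Banach space. Then $\mathcal{A}(X)$ satisfies $(L_U)$ in each of the following cases: (i) $U=C_b(\mathbb{R},X)$ and $X$ has no subspace isomorphic to $c_0$; (ii) $U=C_{b,wscp}(\mathbb{R},X)$. **(b)** $\mathcal{A}(\mathbb{C})$ does not satisfy $(P_b)$: the function $g(t)=e^{it^2}$ belongs to $\mathcal{A}(\mathbb{C})$ and $Pg\in C_b(\mathbb{R},\mathbb{C})$, but $Pg\notin\mathcal{A}(\mathbb{C})$.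 Moreover $\mathcal{A}(\mathbb{C})\subset MIN(\mathbb{R}_d,\mathbb{C})\cap C(\mathbb{R},\mathbb{C})$, and $REC(\mathbb{R}_d,\mathbb{C})\cap C_b(\mathbb{R},\mathbb{C})=MIN(\mathbb{R}_d,\mathbb{C})\cap C_b(\mathbb{R},\mathbb{C})$. **(c)** The inclusions $\mathcal{A}(\mathbb{C})\subset\mathcal{M}(\mathcal{A}(\mathbb{C}))$ and $\mathcal{A}_b(\mathbb{C})\subset\mathcal{M}(\mathcal{A}_b(\mathbb{C}))$ are both false. In particular, for $X=\mathbb{C}$ and $U=C_b(\mathbb{R},\mathbb{C})$, the class $\mathcal{A}(\mathbb{C})$ satisfies $(L_U)$ but not $(P_U)$. -/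

import Mathlib

open Set Filter Topology MeasureTheory
open scoped Pointwise ZeroAtInfty

noncomputable section

/-- The additive group `ℝ`, to be equipped with the discrete topology. -/
def DiscreteReal : Type := ℝ

namespace DiscreteReal

instance : AddCommGroup DiscreteReal := inferInstanceAs (AddCommGroup ℝ)

instance : TopologicalSpace DiscreteReal := ⊥

instance : DiscreteTopology DiscreteReal := ⟨rfl⟩

/-- The identity map from `ℝ` with the discrete topology to `ℝ`, as a group isomorphism. -/
def toReal : DiscreteReal ≃+ ℝ := AddEquiv.refl ℝ

end DiscreteReal

section Recurrence

/-- The set `E(f, ε, K)` of `ε`-`K`-periods of `f : G → X`. -/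
def almostPeriods {G X : Type*} [AddCommGroup G] [NormedAddCommGroup X]
    (f : G → X) (ε : ℝ) (K : Set G) : Set G :=
  {τ | ∀ t ∈ K, ‖f (t + τ) - f t‖ ≤ ε}

/-- `E ⊆ G` is relatively dense if `E + L = G` for some compact `L ⊆ G`. -/
def RelativelyDense {G : Type*} [AddCommGroup G] [TopologicalSpace G] (E : Set G) : Prop :=
  ∃ L : Set G, IsCompact L ∧ E + L = univ

/-- The set `REC(G, X)` of recurrent functions `G → X`. -/
def REC (G X : Type*) [AddCommGroup G] [TopologicalSpace G] [NormedAddCommGroup X] :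
    Set (G → X) :=
  {f | Continuous f ∧
    ∀ K : Set G, IsCompact K → ∀ ε : ℝ, 0 < ε → RelativelyDense (almostPeriods f ε K)}

/-- The translate `t ↦ f (t + s)` of a continuous function. -/
def translateC {G X : Type*} [AddCommGroup G] [TopologicalSpace G] [ContinuousAdd G]
    [NormedAddCommGroup X] (s : G) (f : C(G, X)) : C(G, X) :=
  ⟨fun t => f (t + s), f.continuous.comp (continuous_id.add continuous_const)⟩

/-- The orbit of `f`: the closure of the set of all translates of `f` in `C(G, X)` with the topology
of uniform convergence on compact sets (Mathlib's topology on `C(G, X)`). -/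
def orbitC {G X : Type*} [AddCommGroup G] [TopologicalSpace G] [ContinuousAdd G]
    [NormedAddCommGroup X] (f : C(G, X)) : Set C(G, X) :=
  closure (range fun s : G => translateC s f)

/-- `f` is minimal if its orbit has no proper nonempty closed invariant subset. -/
def IsMinimalFun {G X : Type*} [AddCommGroup G] [TopologicalSpace G] [ContinuousAdd G]
    [NormedAddCommGroup X] (f : C(G, X)) : Prop :=
  ∀ U : Set C(G, X), U ⊆ orbitC f → U.Nonempty → IsClosed U →
    (∀ g ∈ U, ∀ s : G, translateC s g ∈ U) → U = orbitC f

/-- The set `MIN(G, X)` of minimal functions `G → X`. -/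
def MIN (G X : Type*) [AddCommGroup G] [TopologicalSpace G] [ContinuousAdd G]
    [NormedAddCommGroup X] : Set (G → X) :=
  {f | ∃ hf : Continuous f, IsMinimalFun (⟨f, hf⟩ : C(G, X))}

end Recurrence

section RealLine

/-- The class `𝒜 = REC(ℝ_d, X) ∩ C(ℝ, X)`. -/
def recDiscrete (X : Type*) [NormedAddCommGroup X] : Set (ℝ → X) :=
  {f | f ∘ DiscreteReal.toReal ∈ REC DiscreteReal X ∧ Continuous f}

/-- The class `MIN(ℝ_d, X) ∩ C(ℝ, X)`. -/
def minDiscrete (X : Type*) [NormedAddCommGroup X] : Set (ℝ → X) :=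
  {f | f ∘ DiscreteReal.toReal ∈ MIN DiscreteReal X ∧ Continuous f}

/-- `C_b(ℝ, X)`, the bounded continuous functions. -/
def boundedCont (X : Type*) [NormedAddCommGroup X] : Set (ℝ → X) :=
  {f | Continuous f ∧ ∃ C : ℝ, ∀ t, ‖f t‖ ≤ C}

/-- `M ⊆ X` is relatively weakly sequentially complete: every weakly Cauchy sequence in `M`
converges weakly to some point of `X`. -/
def RelWeaklySeqComplete (𝕜 : Type*) [RCLike 𝕜] {X : Type*} [NormedAddCommGroup X]
    [NormedSpace 𝕜 X] (M : Set X) : Prop :=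
  ∀ x : ℕ → X, (∀ n, x n ∈ M) → (∀ φ : X →L[𝕜] 𝕜, CauchySeq fun n => φ (x n)) →
    ∃ a : X, ∀ φ : X →L[𝕜] 𝕜, Tendsto (fun n => φ (x n)) atTop (𝓝 (φ a))

/-- `C_{b,wscp}(ℝ, X)`, the bounded continuous functions whose range is relatively weakly
sequentially complete. -/
def boundedContWscp (𝕜 : Type*) [RCLike 𝕜] (X : Type*) [NormedAddCommGroup X]
    [NormedSpace 𝕜 X] : Set (ℝ → X) :=
  {f | f ∈ boundedCont X ∧ RelWeaklySeqComplete 𝕜 (range f)}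

/-- `X` contains a subspace isomorphic to the Banach space `c₀`. -/
def ContainsC0 (𝕜 : Type*) [RCLike 𝕜] (X : Type*) [NormedAddCommGroup X]
    [NormedSpace 𝕜 X] : Prop :=
  ∃ W : Submodule 𝕜 X, Nonempty (C₀(ℕ, 𝕜) ≃L[𝕜] W)

/-- The difference `Δ_h F`. -/
def differenceFun {X : Type*} [NormedAddCommGroup X] (h : ℝ) (F : ℝ → X) : ℝ → X :=
  fun t => F (t + h) - F t

/-- The indefinite integral `Pf` with base point `0`. -/
def indefIntegral {X : Type*} [NormedAddCommGroup X] [NormedSpace ℝ X] (f : ℝ → X) : ℝ → X :=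
  fun t => ∫ s in (0 : ℝ)..t, f s

/-- The mean `M_h f`. -/
def meanFun {X : Type*} [NormedAddCommGroup X] [NormedSpace ℝ X] (h : ℝ) (f : ℝ → X) : ℝ → X :=
  fun t => (1 / h) • ∫ s in (0 : ℝ)..h, f (t + s)

/-- The mean class `ℳ𝒜` of a class `𝒜` of functions on `ℝ`. -/
def meanClass {X : Type*} [NormedAddCommGroup X] [NormedSpace ℝ X] (A : Set (ℝ → X)) :
    Set (ℝ → X) :=
  {f | LocallyIntegrable f volume ∧ ∀ h : ℝ, 0 < h → meanFun h f ∈ A}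

/-- The Loomis condition `(L_U)` for `𝒜`. -/
def SatisfiesL {X : Type*} [NormedAddCommGroup X] (A U : Set (ℝ → X)) : Prop :=
  ∀ F ∈ U, (∀ h : ℝ, 0 < h → differenceFun h F ∈ A) → F ∈ A

/-- The integration condition `(P_U)` for `𝒜`. -/
def SatisfiesP {X : Type*} [NormedAddCommGroup X] [NormedSpace ℝ X] (A U : Set (ℝ → X)) : Prop :=
  ∀ f ∈ A, LocallyIntegrable f volume → indefIntegral f ∈ U → indefIntegral f ∈ A

/-- The function `t ↦ e^{it²}`. -/
def quadraticPhase : ℝ → ℂ := fun t => Complex.exp (Complex.I * (t : ℂ) ^ 2)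

end RealLine

end

/-!
**The Loomis condition.** Write `A_τ t = F (t + τ) - F t`. Suppose that `F` is bounded and
continuous and that all its differences are recurrent on the discrete line, but `F` is not.
Recurrence of the single function `Δ_{1/N} F` makes `A_τ` nearly constant on large pieces of `t₀ +
ℤ / N` for a relatively dense set of `τ`, and non-recurrence of `F` provides such `τ` for which
that constant is not small. Since `F` is continuous, `τ` can be moved to a rational number, so
that the construction can be iterated along sums of the translations already found
(`exists_rat_translation_of_notMem_recDiscrete`, `exists_additive_increments`). The outcome is a
sequence `v n` in `X`, bounded away from `0`, and real numbers `σ n` with `F (t₀ + ∑ σ i) = F t₀ +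
∑ v i` up to summable errors, for all finite sums; boundedness of `F` bounds all finite subset
sums of `v`. By the Bessaga–Pełczyński theorem (`containsC0_of_norm_sum_le`) `X` contains `c₀`;
and by a weak form of the Orlicz–Pettis theorem (`exists_subseq_not_weakly_convergent`) some
sequence in the range of `F` is weakly Cauchy without having a weak limit. Both rest on a version
of Rosenthal's lemma (`exists_subseq_almost_biorthogonal`). Joint recurrence of several
differences is never needed.

**The quadratic phase.** A set belonging to all idempotent ultrafilters is relatively dense
(`relativelyDense_of_forall_idempotent`), and along an idempotent ultrafilter both `e^{2iτt}` and
`e^{iτ²}` tend to `1`, so that `e^{it²}` is recurrent. Its integrals over `[τ, τ + t]` vanish as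
`|τ| → ∞`. As almost periods are unbounded, a recurrent indefinite integral would have to be
constant and a recurrent mean would have to vanish; neither is the case.

**Minimal functions.** Recurrence implies minimality by moving almost periods through the orbit
closure; conversely, for bounded functions with values in a proper space, limits along an
ultrafilter concentrated on a thick set without almost periods would contradict minimality.
-/

/-! ### Relative density in discrete groups -/

theorem RelativelyDense.mono {G : Type*} [AddCommGroup G] [TopologicalSpace G] {E E' : Set G}
    (h : RelativelyDense E) (hE : E ⊆ E') : RelativelyDense E' := by
  obtain ⟨L, hL, hEL⟩ := h
  exact ⟨L, hL, univ_subset_iff.1 (hEL ▸ add_subset_add_right hE)⟩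

theorem relativelyDense_iff_exists_finset {G : Type*} [AddCommGroup G] [TopologicalSpace G]
    [DiscreteTopology G] {E : Set G} :
    RelativelyDense E ↔ ∃ L : Finset G, ∀ s, ∃ l ∈ L, s - l ∈ E := by
  constructor
  · rintro ⟨L, hL, hEL⟩
    refine ⟨(isCompact_iff_finite.1 hL).toFinset, fun s => ?_⟩
    obtain ⟨e, he, l, hl, rfl⟩ : s ∈ E + L := hEL ▸ mem_univ s
    exact ⟨l, by simpa using hl, by simpa using he⟩
  · rintro ⟨L, hL⟩
    refine ⟨L, L.finite_toSet.isCompact, eq_univ_of_forall fun s => ?_⟩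
    obtain ⟨l, hl, he⟩ := hL s
    exact ⟨s - l, he, l, hl, by simp⟩

/-- A set that is not relatively dense has a thick complement; the corresponding left ideal of
ultrafilters is nonempty. -/
theorem exists_ultrafilter_of_not_relativelyDense {G : Type*} [AddCommGroup G]
    [TopologicalSpace G] [DiscreteTopology G] {E : Set G} (h : ¬ RelativelyDense E) :
    ∃ p : Ultrafilter G, ∀ l, ∀ᶠ s in p, s - l ∉ E := by
  rw [relativelyDense_iff_exists_finset] at h
  push Not at h
  choose s hs using h
  refine ⟨Ultrafilter.of (map s atTop), fun l => Ultrafilter.of_le _ ?_⟩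
  rw [mem_map]
  filter_upwards [eventually_ge_atTop {l}] with L hL
  exact hs L l (hL (Finset.mem_singleton_self l))

attribute [local instance] Ultrafilter.add Ultrafilter.addSemigroup

/-- A set that belongs to every idempotent ultrafilter is relatively dense: otherwise the closed
left ideal of ultrafilters containing all translates of its complement would, by Ellis' lemma,
contain an idempotent. -/
theorem relativelyDense_of_forall_idempotent {G : Type*} [AddCommGroup G]
    [TopologicalSpace G] [DiscreteTopology G] {E : Set G}
    (h : ∀ p : Ultrafilter G, p + p = p → ∀ᶠ s in p, s ∈ E) : RelativelyDense E := by
  by_contra hE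
  obtain ⟨p, hp, hpp⟩ := exists_idempotent_in_compact_add_subsemigroup
    (Ultrafilter.continuous_add_left (M := G))
    {p : Ultrafilter G | ∀ l : G, ∀ᶠ s : G in (p : Filter G), s - l ∉ E}
    (exists_ultrafilter_of_not_relativelyDense hE)
    (by
      refine IsClosed.isCompact ?_
      have : {p : Ultrafilter G | ∀ l, ∀ᶠ s in p, s - l ∉ E} =
          ⋂ l, {p : Ultrafilter G | {s | s - l ∉ E} ∈ p} := by
        ext p; simp only [mem_iInter]; rfl
      rw [this]
      exact isClosed_iInter fun l => ultrafilter_isClosed_basic _)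
    (by
      intro p _ q hq l
      rw [Ultrafilter.eventually_add]
      refine Eventually.of_forall fun x => ?_
      filter_upwards [hq (l - x)] with y hy
      rwa [show x + y - l = y - (l - x) by abel])
  obtain ⟨s, hs, hs'⟩ := ((hp 0).and (h p hpp)).exists
  exact hs (by simpa using hs')

/-! ### Recurrent and minimal functions -/

section Minimal

theorem mem_closure_continuousMap_iff {G X : Type*} [TopologicalSpace G] [NormedAddCommGroup X]
    {S : Set C(G, X)} {g : C(G, X)} :
    g ∈ closure S ↔ ∀ K : Set G, IsCompact K → ∀ ε : ℝ, 0 < ε →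
      ∃ f ∈ S, ∀ t ∈ K, ‖f t - g t‖ < ε := by
  have hb := nhds_basis_uniformity' (x := g)
    ((Metric.uniformity_basis_dist (α := X)).compactConvergenceUniformity (α := G))
  rw [mem_closure_iff_nhds_basis hb]
  simp only [Prod.forall]
  constructor
  · intro h K hK ε hε
    obtain ⟨f, hf, hfg⟩ := h K ε ⟨hK, hε⟩
    refine ⟨f, hf, fun t ht => ?_⟩
    have := hfg t ht
    rw [← dist_eq_norm, dist_comm]
    exact this
  · rintro h K ε ⟨hK, hε⟩
    obtain ⟨f, hf, hfg⟩ := h K hK ε hε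
    refine ⟨f, hf, fun t ht => ?_⟩
    have := hfg t ht
    rw [← dist_eq_norm, dist_comm] at this
    exact this

variable {G X : Type*} [AddCommGroup G] [TopologicalSpace G] [IsTopologicalAddGroup G]
  [NormedAddCommGroup X]

theorem continuous_translateC (s : G) : Continuous (translateC s : C(G, X) → C(G, X)) :=
  ContinuousMap.continuous_precomp ⟨fun t => t + s, continuous_id.add continuous_const⟩

theorem mem_orbitC_iff {f g : C(G, X)} :
    g ∈ orbitC f ↔ ∀ K : Set G, IsCompact K → ∀ ε : ℝ, 0 < ε →
      ∃ s, ∀ t ∈ K, ‖f (t + s) - g t‖ < ε := by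
  simp only [orbitC, mem_closure_continuousMap_iff, exists_range_iff]
  rfl

theorem translateC_mem_orbitC {f g : C(G, X)} (hg : g ∈ orbitC f) (s : G) :
    translateC s g ∈ orbitC f := by
  refine map_mem_closure (continuous_translateC s) hg ?_
  rintro _ ⟨r, rfl⟩
  refine ⟨s + r, ?_⟩
  ext t
  simp [translateC, add_assoc]

theorem self_mem_orbitC (f : C(G, X)) : f ∈ orbitC f :=
  subset_closure ⟨0, by ext t; simp [translateC]⟩

/-- Recurrent functions are minimal: `f` lies in the orbit of each member of its own orbit. -/
theorem REC_subset_MIN : REC G X ⊆ MIN G X := by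
  rintro f ⟨hf, hrec⟩
  refine ⟨hf, fun U hU ⟨g, hgU⟩ hUc hUinv => hU.antisymm ?_⟩
  have hfU : (⟨f, hf⟩ : C(G, X)) ∈ U := by
    rw [← hUc.closure_eq]
    refine closure_mono (s := range fun s => translateC s g) ?_ ?_
    · rintro _ ⟨s, rfl⟩
      exact hUinv g hgU s
    rw [mem_closure_continuousMap_iff]
    intro K hK ε hε
    obtain ⟨L, hL, hEL⟩ := hrec K hK (ε / 2) (half_pos hε)
    obtain ⟨s, hs⟩ := mem_orbitC_iff.1 (hU hgU) _
      ((hK.prod hL).image continuous_sub) (ε / 2) (half_pos hε)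
    obtain ⟨e, he, l, hl, rfl⟩ : s ∈ almostPeriods f (ε / 2) K + L := hEL ▸ mem_univ s
    refine ⟨_, ⟨-l, rfl⟩, fun t ht => ?_⟩
    have h1 := hs (t - l) ⟨(t, l), ⟨ht, hl⟩, rfl⟩
    have h2 := he t ht
    simp only [ContinuousMap.coe_mk, translateC, ← sub_eq_add_neg] at h1 ⊢
    rw [show t - l + (e + l) = t + e by abel, norm_sub_rev] at h1
    calc ‖g (t - l) - f t‖ = ‖(g (t - l) - f (t + e)) + (f (t + e) - f t)‖ := by simp
      _ ≤ _ := norm_add_le _ _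
      _ < ε := by linarith
  refine closure_minimal ?_ hUc
  rintro _ ⟨s, rfl⟩
  exact hUinv _ hfU s

/-- On a discrete group, bounded minimal functions with values in a proper space are recurrent:
their orbits are compact. -/
theorem mem_REC_of_mem_MIN_of_bounded [DiscreteTopology G] [ProperSpace X] {f : G → X}
    (hf : f ∈ MIN G X) {C : ℝ} (hC : ∀ t, ‖f t‖ ≤ C) : f ∈ REC G X := by
  obtain ⟨hfc, hmin⟩ := hf
  refine ⟨hfc, fun K hK ε hε => ?_⟩
  by_contra hE
  obtain ⟨p, hp⟩ := exists_ultrafilter_of_not_relativelyDense hE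
  have hlim : ∀ t : G, ∃ x, Tendsto (fun s : G => f (t + s)) p (𝓝 x) := fun t => by
    obtain ⟨x, -, hx⟩ := (isCompact_closedBall (0 : X) C).ultrafilter_le_nhds
      (p.map fun s : G => f (t + s)) (by
        rw [Ultrafilter.coe_map, le_principal_iff, mem_map]
        exact Eventually.of_forall fun s => by simpa using hC (t + s))
    exact ⟨x, hx⟩
  choose g hg using hlim
  set g' : C(G, X) := ⟨g, continuous_of_discreteTopology⟩ with hg'
  have hgf : g' ∈ orbitC (⟨f, hfc⟩ : C(G, X)) := by
    rw [mem_orbitC_iff]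
    intro K' hK' δ hδ
    have : ∀ᶠ s in p, ∀ t ∈ K', ‖f (t + s) - g t‖ < δ := by
      rw [eventually_all_finite (isCompact_iff_finite.1 hK')]
      intro t _
      have := (hg t).eventually (Metric.ball_mem_nhds _ hδ)
      simpa [dist_eq_norm] using this
    exact this.exists
  have hfg : (⟨f, hfc⟩ : C(G, X)) ∈ orbitC g' := by
    rw [hmin (orbitC g') ?_ ⟨_, self_mem_orbitC _⟩ isClosed_closure
      fun h hh s => translateC_mem_orbitC hh s]
    · exact self_mem_orbitC _
    · refine closure_minimal ?_ isClosed_closure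
      rintro _ ⟨s, rfl⟩
      exact translateC_mem_orbitC hgf s
  obtain ⟨r, hr⟩ := mem_orbitC_iff.1 hfg K hK (ε / 2) (half_pos hε)
  have h1 : ∀ᶠ s in p, ∀ t ∈ K, ‖f (t + r + s) - g (t + r)‖ < ε / 2 := by
    rw [eventually_all_finite (isCompact_iff_finite.1 hK)]
    intro t _
    have := (hg (t + r)).eventually (Metric.ball_mem_nhds _ (half_pos hε))
    simpa [dist_eq_norm] using this
  obtain ⟨s, hs, hs'⟩ := (h1.and (hp (-r))).exists
  refine hs' fun t ht => ?_
  have h1 := hs t ht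
  have h2 := hr t ht
  simp only [hg', ContinuousMap.coe_mk] at h2
  rw [sub_neg_eq_add, show t + (s + r) = t + r + s by abel]
  calc ‖f (t + r + s) - f t‖ = ‖(f (t + r + s) - g (t + r)) + (g (t + r) - f t)‖ := by simp
    _ ≤ _ := norm_add_le _ _
    _ ≤ ε := by linarith

end Minimal

/-! ### Recurrence on the discrete real line -/

section RealLine

variable {X : Type*} [NormedAddCommGroup X] {f : ℝ → X}

theorem mem_recDiscrete_iff :
    f ∈ recDiscrete X ↔ Continuous f ∧ ∀ (K : Finset ℝ) (ε : ℝ), 0 < ε →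
      RelativelyDense (G := DiscreteReal)
        {τ | ∀ t ∈ K, ‖f (t + DiscreteReal.toReal τ) - f t‖ ≤ ε} := by
  constructor
  · rintro ⟨⟨-, h⟩, hf⟩
    refine ⟨hf, fun K ε hε => (h (DiscreteReal.toReal ⁻¹' K) ?_ ε hε).mono ?_⟩
    · exact (K.finite_toSet.preimage DiscreteReal.toReal.injective.injOn).isCompact
    · intro τ hτ t ht
      have := hτ (DiscreteReal.toReal.symm t) (by simpa using ht)
      simpa using this
  · rintro ⟨hf, h⟩
    refine ⟨⟨continuous_of_discreteTopology, fun K hK ε hε => ?_⟩, hf⟩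
    refine (h ((isCompact_iff_finite.1 hK).image DiscreteReal.toReal).toFinset ε hε).mono ?_
    intro τ hτ t ht
    have := hτ (DiscreteReal.toReal t) (by simpa using ht)
    simpa using this

/-- The almost periods of a function in `recDiscrete X` are unbounded. -/
theorem exists_le_abs_of_mem_recDiscrete (hf : f ∈ recDiscrete X) (K : Finset ℝ) {ε : ℝ}
    (hε : 0 < ε) (R : ℝ) : ∃ τ : ℝ, R ≤ |τ| ∧ ∀ t ∈ K, ‖f (t + τ) - f t‖ ≤ ε := by
  obtain ⟨L, hL⟩ := relativelyDense_iff_exists_finset.1 ((mem_recDiscrete_iff.1 hf).2 K ε hε)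
  obtain ⟨l, hl, h⟩ := hL
    (DiscreteReal.toReal.symm (R + ∑ l ∈ L, |DiscreteReal.toReal l|))
  refine ⟨_, ?_, h⟩
  have h1 := Finset.single_le_sum (f := fun l => |DiscreteReal.toReal l|)
    (fun i _ => abs_nonneg _) hl
  have h2 := le_abs_self (DiscreteReal.toReal l)
  simp only [map_sub, AddEquiv.apply_symm_apply] at h1 ⊢
  exact le_trans (by linarith) (le_abs_self _)

/-- A recurrent function that vanishes at infinity is zero. -/
theorem eq_zero_of_mem_recDiscrete_of_tendsto_zero (hf : f ∈ recDiscrete X)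
    (h : ∀ ε > 0, ∃ R : ℝ, ∀ t, R ≤ |t| → ‖f t‖ ≤ ε) (t : ℝ) : f t = 0 := by
  rw [← norm_le_zero_iff]
  refine le_of_forall_pos_le_add fun ε hε => ?_
  obtain ⟨R, hR⟩ := h (ε / 2) (half_pos hε)
  obtain ⟨τ, hτ, hτ'⟩ := exists_le_abs_of_mem_recDiscrete hf {t} (half_pos hε) (R + |t|)
  have h1 := hτ' t (by simp)
  have h2 := hR (t + τ) (by
    have := abs_sub_abs_le_abs_sub τ (-t)
    rw [abs_neg, sub_neg_eq_add, add_comm τ t] at this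
    linarith)
  have := norm_sub_norm_le (f t) (f (t + τ))
  rw [norm_sub_rev] at this
  linarith

end RealLine

/-! ### The quadratic phase -/

section QuadraticPhase

/-- Along an idempotent ultrafilter, the iterated limit of `u (x + y)` is the limit of `u`. -/
theorem eq_of_tendsto_of_idempotent {G Y : Type*} [AddCommGroup G] [MetricSpace Y]
    {p : Ultrafilter G} (hp : p + p = p) {u w : G → Y} {a b : Y} (ha : Tendsto u p (𝓝 a))
    (hw : ∀ x, Tendsto (fun y => u (x + y)) p (𝓝 (w x))) (hb : Tendsto w p (𝓝 b)) : b = a := by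
  refine eq_of_forall_dist_le fun ε hε => ?_
  have h1 : ∀ᶠ m in (p + p : Ultrafilter G), dist (u m) a < ε := by
    rw [hp]
    exact ha.eventually (Metric.ball_mem_nhds _ hε)
  rw [Ultrafilter.eventually_add] at h1
  refine le_of_tendsto (hb.dist tendsto_const_nhds) ?_
  filter_upwards [h1] with x hx
  refine le_of_tendsto ((hw x).dist tendsto_const_nhds) ?_
  filter_upwards [hx] with y hy using hy.le

theorem exists_tendsto_of_norm_eq_one {G : Type*} (p : Ultrafilter G) {u : G → ℂ}
    (hu : ∀ x, ‖u x‖ = 1) : ∃ a, a ≠ 0 ∧ Tendsto u p (𝓝 a) := by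
  obtain ⟨a, ha, h⟩ := (isCompact_sphere (0 : ℂ) 1).ultrafilter_le_nhds (p.map u) (by
    rw [Ultrafilter.coe_map, le_principal_iff, mem_map]
    exact Eventually.of_forall fun s => by simpa using hu s)
  exact ⟨a, ne_zero_of_mem_unit_sphere ⟨a, ha⟩, h⟩

theorem norm_quadraticPhase (t : ℝ) : ‖quadraticPhase t‖ = 1 := by
  rw [quadraticPhase, mul_comm, ← Complex.ofReal_pow, Complex.norm_exp_ofReal_mul_I]

theorem quadraticPhase_add (x y : ℝ) : quadraticPhase (x + y) =
    quadraticPhase x * Complex.exp (((2 * y * x : ℝ) : ℂ) * Complex.I) * quadraticPhase y := by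
  simp only [quadraticPhase, ← Complex.exp_add]
  congr 1
  push_cast
  ring

theorem continuous_quadraticPhase : Continuous quadraticPhase := by
  unfold quadraticPhase; fun_prop

theorem quadraticPhase_mem_boundedCont : quadraticPhase ∈ boundedCont ℂ :=
  ⟨continuous_quadraticPhase, 1, fun t => (norm_quadraticPhase t).le⟩

/-- Along an idempotent ultrafilter `p` every character tends to a solution of `χ = χ ^ 2`, hence
to `1`; the same argument then applies to `e^{iτ²}`, the cross terms `e^{2ixy}` being negligible. -/
theorem quadraticPhase_mem_recDiscrete : quadraticPhase ∈ recDiscrete ℂ := by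
  refine mem_recDiscrete_iff.2 ⟨continuous_quadraticPhase, fun K ε hε =>
    relativelyDense_of_forall_idempotent fun p hp => ?_⟩
  have hχ : ∀ t : ℝ, Tendsto (fun τ : DiscreteReal =>
      Complex.exp (((2 * τ.toReal * t : ℝ) : ℂ) * Complex.I)) p (𝓝 1) := fun t => by
    obtain ⟨a, ha, h⟩ := exists_tendsto_of_norm_eq_one p (u := fun τ : DiscreteReal =>
      Complex.exp (((2 * τ.toReal * t : ℝ) : ℂ) * Complex.I))
      fun τ => Complex.norm_exp_ofReal_mul_I _
    have := eq_of_tendsto_of_idempotent hp h (w := fun τ : DiscreteReal =>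
      Complex.exp (((2 * τ.toReal * t : ℝ) : ℂ) * Complex.I) * a) (b := a * a) (fun x => by
        refine (h.const_mul (Complex.exp (((2 * x.toReal * t : ℝ) : ℂ) * Complex.I))).congr
          fun y => ?_
        rw [← Complex.exp_add]
        congr 1
        simp only [map_add]
        push_cast
        ring) (h.mul_const a)
    rwa [(mul_eq_left₀ ha).1 this] at h
  have hQ : Tendsto (fun τ : DiscreteReal => quadraticPhase τ.toReal) p (𝓝 1) := by
    obtain ⟨a, ha, h⟩ := exists_tendsto_of_norm_eq_one p
      (u := fun τ : DiscreteReal => quadraticPhase τ.toReal) fun τ => norm_quadraticPhase _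
    have := eq_of_tendsto_of_idempotent hp h
      (w := fun τ : DiscreteReal => quadraticPhase τ.toReal * a) (b := a * a) (fun x => by
        have := ((hχ x.toReal).const_mul (quadraticPhase x.toReal)).mul h
        rw [mul_one] at this
        refine this.congr fun y => ?_
        rw [map_add, quadraticPhase_add]) (h.mul_const a)
    rwa [(mul_eq_left₀ ha).1 this] at h
  have hlim : ∀ t : ℝ, Tendsto (fun τ : DiscreteReal => quadraticPhase (t + τ.toReal)) p
      (𝓝 (quadraticPhase t)) := fun t => by
    have := ((hχ t).const_mul (quadraticPhase t)).mul hQ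
    rw [mul_one, mul_one] at this
    exact this.congr fun τ => (quadraticPhase_add _ _).symm
  have : ∀ᶠ τ : DiscreteReal in p, ∀ t ∈ K,
      ‖quadraticPhase (t + τ.toReal) - quadraticPhase t‖ ≤ ε := by
    rw [eventually_all_finset]
    intro t _
    filter_upwards [(hlim t).eventually (Metric.ball_mem_nhds _ hε)] with τ hτ
    rw [← dist_eq_norm]
    exact (Metric.mem_ball.1 hτ).le
  exact this

/-- Integration by parts, with antiderivative `e^{is²} / (2is)` and remainder
`e^{is²} / (2is²)`. -/
theorem norm_integral_quadraticPhase_le_of_pos {a b : ℝ} (ha : 0 < a) (hab : a ≤ b) :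
    ‖∫ s in a..b, quadraticPhase s‖ ≤ 1 / a := by
  have hb : 0 < b := ha.trans_le hab
  have hpos : ∀ s ∈ uIcc a b, 0 < s := fun s hs => by
    rw [uIcc_of_le hab] at hs; exact ha.trans_le hs.1
  set r : ℝ → ℂ := fun s => quadraticPhase s / (2 * Complex.I * s ^ 2) with hr
  have hderiv : ∀ s ∈ uIcc a b, HasDerivAt
      (fun s : ℝ => quadraticPhase s / (2 * Complex.I * s)) (quadraticPhase s - r s) s := by
    intro s hs
    have hs0 : (s : ℂ) ≠ 0 := Complex.ofReal_ne_zero.2 (hpos s hs).ne'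
    have h1 : HasDerivAt (fun s : ℝ => (s : ℂ)) 1 s := Complex.ofRealCLM.hasDerivAt
    have h2 := ((h1.pow 2).const_mul Complex.I).cexp
    have h3 := h2.div (h1.const_mul (2 * Complex.I)) (by simp [hs0])
    refine h3.congr_deriv ?_
    simp only [hr, quadraticPhase]
    field_simp
    simp
    ring
  have hri : ContinuousOn r (uIcc a b) := by
    refine continuous_quadraticPhase.continuousOn.div (by fun_prop) fun s hs => ?_
    have hs0 : (s : ℂ) ≠ 0 := Complex.ofReal_ne_zero.2 (hpos s hs).ne'
    simp [hs0]
  have hqi := continuous_quadraticPhase.intervalIntegrable a b (μ := volume)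
  have h1 := intervalIntegral.integral_eq_sub_of_hasDerivAt hderiv
    (hqi.sub hri.intervalIntegrable)
  rw [intervalIntegral.integral_sub hqi hri.intervalIntegrable, sub_eq_iff_eq_add] at h1
  have h2 : ‖∫ s in a..b, r s‖ ≤ 1 / (2 * a) - 1 / (2 * b) := by
    have h3 : ∀ s ∈ uIcc a b,
        HasDerivAt (fun s : ℝ => -(1 / 2) * s⁻¹) (1 / (2 * s ^ 2)) s := fun s hs => by
      refine ((hasDerivAt_inv (hpos s hs).ne').const_mul (-(1 / 2))).congr_deriv ?_
      have := (hpos s hs).ne'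
      field_simp
    have hi : IntervalIntegrable (fun s : ℝ => 1 / (2 * s ^ 2)) volume a b := by
      refine ContinuousOn.intervalIntegrable ?_
      refine continuousOn_const.div (by fun_prop) fun s hs => ?_
      have := hpos s hs
      positivity
    have h4 := intervalIntegral.integral_eq_sub_of_hasDerivAt h3 hi
    calc ‖∫ s in a..b, r s‖ ≤ ∫ s in a..b, 1 / (2 * s ^ 2) := by
          refine intervalIntegral.norm_integral_le_of_norm_le hab
            (Eventually.of_forall fun s hs => ?_) hi
          simp [hr, norm_quadraticPhase]
      _ = _ := by rw [h4]; field_simp; ring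
  have hn : ∀ s : ℝ, 0 < s → ‖quadraticPhase s / (2 * Complex.I * s)‖ = 1 / (2 * s) := by
    intro s hs
    simp [norm_quadraticPhase, abs_of_pos hs]
  rw [h1]
  calc _ ≤ ‖quadraticPhase b / (2 * Complex.I * b)‖ + ‖quadraticPhase a / (2 * Complex.I * a)‖ +
        ‖∫ s in a..b, r s‖ := (norm_add_le _ _).trans (by gcongr; exact norm_sub_le _ _)
    _ ≤ 1 / (2 * b) + 1 / (2 * a) + (1 / (2 * a) - 1 / (2 * b)) := by
        rw [hn a ha, hn b hb]; gcongr
    _ = 1 / a := by field_simp; ring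

theorem quadraticPhase_neg (t : ℝ) : quadraticPhase (-t) = quadraticPhase t := by
  simp [quadraticPhase]

theorem norm_integral_quadraticPhase_le {a b r : ℝ} (hr : 0 < r)
    (h : (r ≤ a ∧ r ≤ b) ∨ (a ≤ -r ∧ b ≤ -r)) : ‖∫ s in a..b, quadraticPhase s‖ ≤ 1 / r := by
  have key : ∀ a b : ℝ, r ≤ a → r ≤ b → ‖∫ s in a..b, quadraticPhase s‖ ≤ 1 / r := by
    intro a b ha hb
    rcases le_total a b with hab | hab
    · exact (norm_integral_quadraticPhase_le_of_pos (hr.trans_le ha) hab).trans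
        (one_div_le_one_div_of_le hr ha)
    · rw [intervalIntegral.integral_symm, norm_neg]
      exact (norm_integral_quadraticPhase_le_of_pos (hr.trans_le hb) hab).trans
        (one_div_le_one_div_of_le hr hb)
  rcases h with ⟨ha, hb⟩ | ⟨ha, hb⟩
  · exact key a b ha hb
  · have := intervalIntegral.integral_comp_neg (a := a) (b := b) quadraticPhase
    simp only [quadraticPhase_neg] at this
    rw [this]
    exact key _ _ (by linarith) (by linarith)

/-- The integrals of `e^{is²}` over intervals of a fixed length tend to `0` at infinity. -/
theorem norm_integral_quadraticPhase_shift_le (t : ℝ) {ε : ℝ} (hε : 0 < ε) {τ : ℝ}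
    (hτ : |t| + 1 / ε ≤ |τ|) : ‖∫ s in τ..(t + τ), quadraticPhase s‖ ≤ ε := by
  have h0 := one_div_pos.2 hε
  have h1 := abs_le.1 (le_refl |t|)
  rw [← one_div_one_div ε]
  refine norm_integral_quadraticPhase_le h0 ?_
  rcases abs_cases τ with ⟨h, -⟩ | ⟨h, -⟩ <;> rw [h] at hτ
  · left; constructor <;> linarith [abs_nonneg t]
  · right; constructor <;> linarith [abs_nonneg t]

theorem indefIntegral_quadraticPhase_sub (a b : ℝ) :
    indefIntegral quadraticPhase b - indefIntegral quadraticPhase a =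
      ∫ s in a..b, quadraticPhase s :=
  intervalIntegral.integral_interval_sub_left
    (continuous_quadraticPhase.intervalIntegrable _ _)
    (continuous_quadraticPhase.intervalIntegrable _ _)

theorem hasDerivAt_indefIntegral_quadraticPhase (t : ℝ) :
    HasDerivAt (indefIntegral quadraticPhase) (quadraticPhase t) t :=
  continuous_quadraticPhase.integral_hasStrictDerivAt 0 t |>.hasDerivAt

theorem indefIntegral_quadraticPhase_mem_boundedCont :
    indefIntegral quadraticPhase ∈ boundedCont ℂ := by
  refine ⟨continuous_iff_continuousAt.2 fun t =>
    (hasDerivAt_indefIntegral_quadraticPhase t).continuousAt, 2, fun t => ?_⟩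
  have hsmall : ∀ x : ℝ, |x| ≤ 1 → ‖indefIntegral quadraticPhase x‖ ≤ 1 := fun x hx => by
    have := intervalIntegral.norm_integral_le_of_norm_le_const (a := 0) (b := x)
      (f := quadraticPhase) (C := 1) fun s _ => (norm_quadraticPhase s).le
    rw [sub_zero, one_mul] at this
    exact this.trans hx
  have hlarge : ∀ x : ℝ, |x| ≤ 1 → (1 ≤ x ∧ 1 ≤ t ∨ x ≤ -1 ∧ t ≤ -1) →
      ‖indefIntegral quadraticPhase t‖ ≤ 2 := fun x hx hxt => by
    have h1 := norm_integral_quadraticPhase_le one_pos hxt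
    rw [← indefIntegral_quadraticPhase_sub] at h1
    have h2 := norm_le_norm_add_norm_sub' (indefIntegral quadraticPhase t)
      (indefIntegral quadraticPhase x)
    linarith [hsmall x hx]
  rcases le_total |t| 1 with h | h
  · linarith [hsmall t h]
  · rcases le_abs'.1 h with h | h
    · exact hlarge (-1) (by simp) (Or.inr ⟨le_rfl, h⟩)
    · exact hlarge 1 (by simp) (Or.inl ⟨le_rfl, h⟩)

/-- The indefinite integral `P` of `e^{is²}` is slowly oscillating, so that `P (t + τ) ≈ P τ` for
large `τ`; recurrence would give `P t = P 0` for all `t`. -/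
theorem indefIntegral_quadraticPhase_notMem_recDiscrete :
    indefIntegral quadraticPhase ∉ recDiscrete ℂ := by
  intro h
  have h0 : indefIntegral quadraticPhase 0 = 0 := intervalIntegral.integral_same
  have hzero : ∀ t, indefIntegral quadraticPhase t = 0 := fun t => by
    rw [← norm_le_zero_iff]
    refine le_of_forall_pos_le_add fun ε hε => ?_
    obtain ⟨τ, hτ, hrec⟩ := exists_le_abs_of_mem_recDiscrete h {0, t}
      (show 0 < ε / 3 by positivity) (|t| + 1 / (ε / 3))
    have h1 := hrec 0 (by simp)
    have h2 := hrec t (by simp)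
    have h3 := norm_integral_quadraticPhase_shift_le t (by positivity) hτ
    rw [← indefIntegral_quadraticPhase_sub] at h3
    rw [zero_add, h0, sub_zero] at h1
    rw [norm_sub_rev] at h2
    set P := indefIntegral quadraticPhase
    calc ‖P t‖ = ‖(P t - P (t + τ)) + (P (t + τ) - P τ) + P τ‖ := by simp
      _ ≤ ‖P t - P (t + τ)‖ + ‖P (t + τ) - P τ‖ + ‖P τ‖ := norm_add₃_le
      _ ≤ 0 + ε := by linarith
  have h1 := hasDerivAt_indefIntegral_quadraticPhase 0
  rw [show indefIntegral quadraticPhase = fun _ => 0 from funext hzero] at h1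
  have := h1.unique (hasDerivAt_const 0 0)
  simp [quadraticPhase] at this

/-- The mean of `e^{is²}` over unit intervals vanishes at infinity without being identically zero,
hence is not recurrent. -/
theorem meanFun_one_quadraticPhase_notMem_recDiscrete :
    meanFun 1 quadraticPhase ∉ recDiscrete ℂ := by
  intro h
  have hmean : ∀ t, meanFun 1 quadraticPhase t = ∫ s in t..(1 + t), quadraticPhase s := by
    intro t
    simp [meanFun, add_comm]
  have hzero := eq_zero_of_mem_recDiscrete_of_tendsto_zero h fun ε hε =>
    ⟨|1| + 1 / ε, fun t ht => by
      rw [hmean]; exact norm_integral_quadraticPhase_shift_le 1 hε ht⟩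
  have hper : ∀ t, indefIntegral quadraticPhase (1 + t) = indefIntegral quadraticPhase t :=
    fun t => by rw [← sub_eq_zero, indefIntegral_quadraticPhase_sub, ← hmean, hzero]
  have h1 := (hasDerivAt_indefIntegral_quadraticPhase (1 + 0)).comp_const_add 1 0
  rw [funext hper] at h1
  have h2 := congrArg Complex.re (h1.unique (hasDerivAt_indefIntegral_quadraticPhase 0))
  simp [quadraticPhase, Complex.exp_re] at h2
  linarith [Real.cos_one_le]

end QuadraticPhase

/-! ### Series with bounded subset sums -/

section BoundedSubsetSums

theorem sum_abs_le_of_norm_sum_le {ι : Type*} {z : ι → ℝ} {C : ℝ}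
    (h : ∀ S : Finset ι, |∑ i ∈ S, z i| ≤ C) (S : Finset ι) : ∑ i ∈ S, |z i| ≤ 2 * C := by
  classical
  rw [← Finset.sum_filter_add_sum_filter_not S (fun i => 0 ≤ z i)]
  have h1 : ∑ i ∈ S with 0 ≤ z i, |z i| = ∑ i ∈ S with 0 ≤ z i, z i :=
    Finset.sum_congr rfl fun i hi => abs_of_nonneg (Finset.mem_filter.1 hi).2
  have h2 : ∑ i ∈ S with ¬ 0 ≤ z i, |z i| = -∑ i ∈ S with ¬ 0 ≤ z i, z i := by
    rw [← Finset.sum_neg_distrib]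
    exact Finset.sum_congr rfl fun i hi => abs_of_neg (not_le.1 (Finset.mem_filter.1 hi).2)
  rw [h1, h2]
  have h3 := abs_le.1 (h {i ∈ S | 0 ≤ z i})
  have h4 := abs_le.1 (h {i ∈ S | ¬ 0 ≤ z i})
  linarith [h3.2, h4.1]

variable {𝕜 : Type*} [RCLike 𝕜] {X : Type*} [NormedAddCommGroup X] [NormedSpace 𝕜 X]
  {v : ℕ → X} {C ε : ℝ}

theorem sum_norm_le_of_norm_sum_le {ι : Type*} {z : ι → 𝕜} {C : ℝ}
    (h : ∀ S : Finset ι, ‖∑ i ∈ S, z i‖ ≤ C) (S : Finset ι) : ∑ i ∈ S, ‖z i‖ ≤ 4 * C := by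
  have hre := sum_abs_le_of_norm_sum_le (z := fun i => RCLike.re (z i)) (C := C) (fun S => by
    rw [← map_sum]; exact (RCLike.abs_re_le_norm _).trans (h S)) S
  have him := sum_abs_le_of_norm_sum_le (z := fun i => RCLike.im (z i)) (C := C) (fun S => by
    rw [← map_sum]; exact (RCLike.abs_im_le_norm _).trans (h S)) S
  calc ∑ i ∈ S, ‖z i‖ ≤ ∑ i ∈ S, (|RCLike.re (z i)| + |RCLike.im (z i)|) :=
        Finset.sum_le_sum fun i _ => by
          rw [← sq_le_sq₀ (norm_nonneg _) (by positivity), ← RCLike.normSq_eq_def',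
            RCLike.normSq_apply, add_sq, sq_abs, sq_abs]
          nlinarith [mul_nonneg (abs_nonneg (RCLike.re (z i))) (abs_nonneg (RCLike.im (z i)))]
    _ ≤ 4 * C := by rw [Finset.sum_add_distrib]; linarith

theorem norm_apply_le_of_norm_le_one {φ : X →L[𝕜] 𝕜} (hφ : ‖φ‖ ≤ 1) (x : X) : ‖φ x‖ ≤ ‖x‖ := by
  simpa using φ.le_of_opNorm_le hφ x

theorem sum_norm_dual_apply_le (hC : ∀ S : Finset ℕ, ‖∑ i ∈ S, v i‖ ≤ C) {φ : X →L[𝕜] 𝕜}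
    (hφ : ‖φ‖ ≤ 1) (S : Finset ℕ) : ∑ i ∈ S, ‖φ (v i)‖ ≤ 4 * C :=
  sum_norm_le_of_norm_sum_le (fun S => by
    rw [← map_sum]; exact (norm_apply_le_of_norm_le_one hφ _).trans (hC S)) S

variable (𝕜) in
theorem norm_sum_smul_le_of_norm_sum_le (hC : ∀ S : Finset ℕ, ‖∑ i ∈ S, v i‖ ≤ C) {a : ℕ → 𝕜}
    {m : ℝ} {S : Finset ℕ} (hm : 0 ≤ m) (ha : ∀ i ∈ S, ‖a i‖ ≤ m) :
    ‖∑ i ∈ S, a i • v i‖ ≤ m * (4 * C) := by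
  obtain ⟨φ, hφ, h⟩ := exists_dual_vector'' 𝕜 (∑ i ∈ S, a i • v i)
  calc ‖∑ i ∈ S, a i • v i‖ = ‖φ (∑ i ∈ S, a i • v i)‖ := by simp [h]
    _ ≤ ∑ i ∈ S, ‖a i‖ * ‖φ (v i)‖ := by
        rw [map_sum]
        refine (norm_sum_le _ _).trans_eq (Finset.sum_congr rfl fun i _ => ?_)
        rw [map_smul, smul_eq_mul, norm_mul]
    _ ≤ ∑ i ∈ S, m * ‖φ (v i)‖ := Finset.sum_le_sum fun i hi => by gcongr; exact ha i hi
    _ ≤ _ := by rw [← Finset.mul_sum]; gcongr; exact sum_norm_dual_apply_le hC hφ S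

theorem exists_forall_sum_le_of_sum_le {w : ℕ → ℝ} (hw : ∀ i, 0 ≤ w i) {c : ℝ}
    (hc : ∀ S : Finset ℕ, ∑ i ∈ S, w i ≤ c) {δ : ℝ} (hδ : 0 < δ) :
    ∃ N, ∀ S : Finset ℕ, (∀ i ∈ S, N ≤ i) → ∑ i ∈ S, w i ≤ δ := by
  obtain ⟨s, hs⟩ := summable_iff_vanishing_norm.1 (summable_of_sum_le hw hc) δ hδ
  refine ⟨s.sup id + 1, fun S hS => ?_⟩
  have := hs S (Finset.disjoint_left.2 fun i hi his => by
    have h1 := hS i hi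
    have h2 := Finset.le_sup (f := id) his
    simp only [id] at h2
    lia)
  exact (le_abs_self _).trans this.le

variable (𝕜) in
/-- A form of Rosenthal's lemma: along a subsequence, norming functionals of the terms of a series
with bounded subset sums are almost biorthogonal to the terms. The entries `f k (v (g i))` with
`i < k` are controlled by their limit in `k` along an ultrafilter, the ones with `i > k` by the
tails of an absolutely convergent series. -/
theorem exists_subseq_almost_biorthogonal (hC : ∀ S : Finset ℕ, ‖∑ i ∈ S, v i‖ ≤ C)
    (hv : ∀ n, ε ≤ ‖v n‖) {δ : ℝ} (hδ : 0 < δ) :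
    ∃ g : ℕ → ℕ, StrictMono g ∧ ∃ f : ℕ → X →L[𝕜] 𝕜, (∀ k, ‖f k‖ ≤ 1) ∧
      (∀ k, ε ≤ ‖f k (v (g k))‖) ∧
      ∀ k, ∀ S : Finset ℕ, k ∉ S → ∑ i ∈ S, ‖f k (v (g i))‖ ≤ δ := by
  choose φ hφ hφv using fun n => exists_dual_vector'' 𝕜 (v n)
  set p := hyperfilter ℕ
  have hlim : ∀ m, ∃ y, Tendsto (fun n => ‖φ n (v m)‖) p (𝓝 y) := fun m => by
    obtain ⟨y, -, hy⟩ := (isCompact_Icc (a := 0) (b := ‖v m‖)).ultrafilter_le_nhds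
      (p.map fun n => ‖φ n (v m)‖) (by
        rw [Ultrafilter.coe_map, le_principal_iff, mem_map]
        exact Eventually.of_forall fun n =>
          ⟨norm_nonneg _, norm_apply_le_of_norm_le_one (hφ n) _⟩)
    exact ⟨y, hy⟩
  choose ψ hψ using hlim
  have hψ0 : ∀ m, 0 ≤ ψ m := fun m => ge_of_tendsto' (hψ m) fun _ => norm_nonneg _
  have hψC : ∀ S : Finset ℕ, ∑ m ∈ S, ψ m ≤ 4 * C := fun S =>
    le_of_tendsto' (tendsto_finsetSum S fun m _ => hψ m) fun n =>
      sum_norm_dual_apply_le hC (hφ n) S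
  obtain ⟨N, hN⟩ := exists_forall_sum_le_of_sum_le hψ0 hψC (show 0 < δ / 4 by positivity)
  have htail : ∀ m, ∃ M, ∀ S : Finset ℕ, (∀ i ∈ S, M ≤ i) → ∑ i ∈ S, ‖φ m (v i)‖ ≤ δ / 4 :=
    fun m => exists_forall_sum_le_of_sum_le (fun _ => norm_nonneg _)
      (sum_norm_dual_apply_le hC (hφ m)) (by positivity)
  choose M hM using htail
  obtain ⟨g, hgN, hg⟩ := exists_seq_of_forall_finset_exists (fun n => N ≤ n)
    (fun m n => m < n ∧ M m ≤ n ∧ ‖φ n (v m)‖ ≤ ψ m + δ / 4 * (1 / 2) ^ m) (fun s _ => by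
      have hlarge : ∀ n₀ : ℕ, ∀ᶠ n in p, n₀ ≤ n := fun n₀ =>
        (Nat.hyperfilter_le_atTop (eventually_ge_atTop n₀))
      have : ∀ᶠ n in p, ∀ m ∈ s,
          m < n ∧ M m ≤ n ∧ ‖φ n (v m)‖ ≤ ψ m + δ / 4 * (1 / 2) ^ m := by
        rw [eventually_all_finset]
        intro m _
        filter_upwards [hlarge (m + 1), hlarge (M m), (hψ m).eventually
          (eventually_le_nhds (show ψ m < ψ m + δ / 4 * (1 / 2) ^ m by
            have : 0 < δ / 4 * (1 / 2) ^ m := by positivity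
            linarith))] with n h1 h2 h3
        exact ⟨h1, h2, h3⟩
      exact ((hlarge N).and this).exists)
  have hgm : StrictMono g := fun m n hmn => (hg m n hmn).1
  refine ⟨g, hgm, fun k => φ (g k), fun k => hφ _, fun k => ?_, fun k S hk => ?_⟩
  · rw [hφv]
    simpa using hv (g k)
  · have hsub : ∀ (T : Finset ℕ) (w : ℕ → ℝ),
        ∑ i ∈ T, w (g i) = ∑ j ∈ T.map ⟨g, hgm.injective⟩, w j := fun T w => by simp
    rw [← Finset.sum_filter_add_sum_filter_not S (fun i => i < k)]
    have h1 : ∑ i ∈ S with i < k, ‖φ (g k) (v (g i))‖ ≤ δ / 4 + δ / 4 * 2 := by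
      calc _ ≤ ∑ i ∈ S with i < k, (ψ (g i) + δ / 4 * (1 / 2) ^ (g i)) :=
            Finset.sum_le_sum fun i hi => (hg i k (Finset.mem_filter.1 hi).2).2.2
        _ ≤ _ := by
            rw [Finset.sum_add_distrib, ← Finset.mul_sum, hsub _ ψ,
              hsub _ fun j => (1 / 2 : ℝ) ^ j]
            gcongr
            · refine hN _ fun j hj => ?_
              obtain ⟨i, -, rfl⟩ := Finset.mem_map.1 hj
              exact hgN i
            · exact (summable_geometric_two.sum_le_tsum _ fun _ _ => by positivity).trans_eq
                tsum_geometric_two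
    have h2 : ∑ i ∈ S with ¬ i < k, ‖φ (g k) (v (g i))‖ ≤ δ / 4 := by
      rw [hsub _ fun j => ‖φ (g k) (v j)‖]
      refine hM _ _ fun j hj => ?_
      obtain ⟨i, hi, rfl⟩ := Finset.mem_map.1 hj
      rw [Finset.mem_filter] at hi
      have : i ≠ k := fun h => hk (h ▸ hi.1)
      exact (hg k i (by lia)).2.1
    linarith

/-- The lower `c₀`-estimate for an almost biorthogonal system. -/
theorem mul_norm_coeff_le_norm_sum {w : ℕ → X} {f : ℕ → X →L[𝕜] 𝕜} {δ : ℝ} (hδ : δ ≤ ε)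
    (hf : ∀ k, ‖f k‖ ≤ 1) (hfw : ∀ k, ε ≤ ‖f k (w k)‖)
    (hfs : ∀ k, ∀ S : Finset ℕ, k ∉ S → ∑ i ∈ S, ‖f k (w i)‖ ≤ δ) (a : ℕ → 𝕜) {S : Finset ℕ}
    {i : ℕ} (hi : i ∈ S) : (ε - δ) * ‖a i‖ ≤ ‖∑ i ∈ S, a i • w i‖ := by
  obtain ⟨j, hj, hmax⟩ := S.exists_max_image (fun i => ‖a i‖) ⟨i, hi⟩
  have h1 : ‖∑ i ∈ S.erase j, a i * f j (w i)‖ ≤ ‖a j‖ * δ := by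
    calc _ ≤ ∑ i ∈ S.erase j, ‖a j‖ * ‖f j (w i)‖ := by
          refine (norm_sum_le _ _).trans (Finset.sum_le_sum fun i hi => ?_)
          rw [norm_mul]
          gcongr
          exact hmax i (Finset.mem_of_mem_erase hi)
      _ ≤ _ := by rw [← Finset.mul_sum]; gcongr; exact hfs j _ (by simp)
  have h2 : ‖a j‖ * ε ≤ ‖a j * f j (w j)‖ := by rw [norm_mul]; gcongr; exact hfw j
  have h3 := norm_apply_le_of_norm_le_one (hf j) (∑ i ∈ S, a i • w i)
  simp only [map_sum, map_smul, smul_eq_mul] at h3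
  rw [← Finset.add_sum_erase S _ hj] at h3
  have h4 := norm_sub_le_norm_add (a j * f j (w j)) (∑ i ∈ S.erase j, a i * f j (w i))
  calc (ε - δ) * ‖a i‖ ≤ (ε - δ) * ‖a j‖ := 
        mul_le_mul_of_nonneg_left (hmax i hi) (sub_nonneg.2 hδ)
    _ ≤ _ := by linarith

variable (𝕜) in
theorem containsC0_of_antilipschitz [CompleteSpace X] (T : C₀(ℕ, 𝕜) →L[𝕜] X) {c : ℝ} (hc : 0 < c)
    (hT : ∀ x, c * ‖x‖ ≤ ‖T x‖) : ContainsC0 𝕜 X := by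
  have hanti : AntilipschitzWith (Real.toNNReal c⁻¹) T :=
    T.antilipschitz_of_bound fun x => by
      rw [Real.coe_toNNReal _ (by positivity), inv_mul_eq_div, le_div_iff₀ hc, mul_comm]
      exact hT x
  exact ⟨_, ⟨T.equivRange hanti.injective (hanti.isClosed_range T.uniformContinuous)⟩⟩

variable (𝕜) in
/-- The Bessaga–Pełczyński theorem: a series with bounded subset sums whose terms stay away from
zero spans, along a subsequence, a copy of `c₀`. -/
theorem containsC0_of_norm_sum_le [CompleteSpace X] (hC : ∀ S : Finset ℕ, ‖∑ i ∈ S, v i‖ ≤ C)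
    (hε : 0 < ε) (hv : ∀ n, ε ≤ ‖v n‖) : ContainsC0 𝕜 X := by
  obtain ⟨g, hg, f, hf, hfv, hfs⟩ := exists_subseq_almost_biorthogonal 𝕜 hC hv (half_pos hε)
  have hCg : ∀ S : Finset ℕ, ‖∑ i ∈ S, v (g i)‖ ≤ C := fun S => by
    have := hC (S.map ⟨g, hg.injective⟩)
    rwa [Finset.sum_map] at this
  have hC0 : 0 ≤ 4 * C := by
    have := hC ∅
    rw [Finset.sum_empty, norm_zero] at this
    positivity
  have hnorm : ∀ (x : C₀(ℕ, 𝕜)) i, ‖x i‖ ≤ ‖x‖ := fun x i => x.toBCF.norm_coe_le_norm i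
  have hsum : ∀ x : C₀(ℕ, 𝕜), Summable fun i => x i • v (g i) := fun x => by
    rw [summable_iff_vanishing_norm]
    intro η hη
    have hx := x.zero_at_infty'
    rw [cocompact_eq_atTop] at hx
    obtain ⟨n, hn⟩ := eventually_atTop.1 (hx.eventually (Metric.ball_mem_nhds (0 : 𝕜)
      (show 0 < η / (4 * C + 1) by positivity)))
    refine ⟨Finset.range n, fun S hS => ?_⟩
    refine (norm_sum_smul_le_of_norm_sum_le 𝕜 hCg (m := η / (4 * C + 1)) (by positivity)
      fun i hi => ?_).trans_lt ?_
    · have := hn i (by simpa using Finset.disjoint_left.1 hS hi)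
      exact (mem_ball_zero_iff.1 this).le
    · rw [div_mul_eq_mul_div, div_lt_iff₀ (by positivity)]
      nlinarith
  let T : C₀(ℕ, 𝕜) →L[𝕜] X := LinearMap.mkContinuous
    { toFun := fun x => ∑' i, x i • v (g i)
      map_add' := fun x y => by
        rw [← (hsum x).tsum_add (hsum y)]
        simp only [ZeroAtInftyContinuousMap.add_apply, add_smul]
      map_smul' := fun c x => by
        rw [RingHom.id_apply, ← (hsum x).tsum_const_smul c]
        simp only [ZeroAtInftyContinuousMap.smul_apply, smul_assoc] } (4 * C) fun x => by
      rw [mul_comm]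
      exact le_of_tendsto' (hsum x).hasSum.norm fun S =>
        norm_sum_smul_le_of_norm_sum_le 𝕜 hCg (norm_nonneg x) fun i _ => hnorm x i
  refine containsC0_of_antilipschitz 𝕜 T (half_pos hε) fun x => ?_
  have hcoord : ∀ i, ε / 2 * ‖x i‖ ≤ ‖T x‖ := fun i => by
    refine ge_of_tendsto (hsum x).hasSum.norm ?_
    filter_upwards [eventually_ge_atTop {i}] with S hS
    have := mul_norm_coeff_le_norm_sum (by linarith) hf hfv hfs x
      (hS (Finset.mem_singleton_self i))
    rwa [sub_half] at this
  rw [← le_div_iff₀' (by positivity), ← ZeroAtInftyContinuousMap.norm_toBCF_eq_norm]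
  refine (BoundedContinuousFunction.norm_le (by positivity)).2 fun i => ?_
  rw [le_div_iff₀' (by positivity)]
  exact hcoord i

/-- Weak limits of sequences in a subspace lie in its norm closure, by the Hahn–Banach theorem in
the quotient. -/
theorem exists_mem_span_norm_sub_lt {w : ℕ → X} {y : ℕ → X} {b : X}
    (hy : ∀ n, y n ∈ Submodule.span 𝕜 (range w))
    (hb : ∀ φ : X →L[𝕜] 𝕜, Tendsto (fun n => φ (y n)) atTop (𝓝 (φ b))) {δ : ℝ} (hδ : 0 < δ) :
    ∃ z ∈ Submodule.span 𝕜 (range w), ‖b - z‖ < δ := by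
  set W := Submodule.span 𝕜 (range w)
  obtain ⟨φ, -, hφ⟩ := exists_dual_vector'' 𝕜 (Submodule.Quotient.mk b : X ⧸ W)
  have h0 : ‖(Submodule.Quotient.mk b : X ⧸ W)‖ = 0 := by
    have h1 := hb (φ.comp W.mkQL)
    have h2 : ∀ n, (φ.comp W.mkQL) (y n) = 0 := fun n => by
      have : W.mkQ (y n) = 0 := by simpa using hy n
      simp [this]
    simp only [h2] at h1
    have h3 := tendsto_nhds_unique h1 tendsto_const_nhds
    simpa [hφ] using h3
  obtain ⟨z, hz, hzn⟩ := Submodule.Quotient.norm_mk_lt (Submodule.Quotient.mk b : X ⧸ W) hδ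
  rw [h0, zero_add] at hzn
  refine ⟨b - z, ?_, by simpa using hzn⟩
  rw [← Submodule.Quotient.mk_eq_zero, Submodule.Quotient.mk_sub, hz, sub_self]

variable (𝕜) in
/-- A weak form of the Orlicz–Pettis theorem: if the subset sums are bounded and the terms stay away
from zero, some subseries has no weak limit. -/
theorem exists_subseq_not_weakly_convergent (hC : ∀ S : Finset ℕ, ‖∑ i ∈ S, v i‖ ≤ C)
    (hε : 0 < ε) (hv : ∀ n, ε ≤ ‖v n‖) :
    ∃ g : ℕ → ℕ, StrictMono g ∧ ¬ ∃ b : X, ∀ φ : X →L[𝕜] 𝕜,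
      Tendsto (fun n => φ (∑ i ∈ Finset.range n, v (g i))) atTop (𝓝 (φ b)) := by
  have hC0 : 0 ≤ C := by simpa using hC ∅
  -- chosen so that a combination of norm at most `C + ε` is nearly annihilated by `f k`, `k` large
  set δ := ε ^ 2 / (16 * (C + ε)) with hδ_def
  have hδ : 0 < δ := by positivity
  have hδε : δ ≤ ε / 16 := by
    rw [hδ_def, div_le_div_iff₀ (by positivity) (by norm_num)]
    nlinarith
  obtain ⟨g, hg, f, hf, hfv, hfs⟩ := exists_subseq_almost_biorthogonal 𝕜 hC hv hδ
  refine ⟨g, hg, fun ⟨b, hb⟩ => ?_⟩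
  have hbC : ‖b‖ ≤ C := by
    obtain ⟨φ, hφ, h⟩ := exists_dual_vector'' 𝕜 b
    have h1 := (hb φ).norm
    rw [h, RCLike.norm_ofReal, abs_norm] at h1
    refine le_of_tendsto' h1 fun n => (norm_apply_le_of_norm_le_one hφ _).trans ?_
    have := hC ((Finset.range n).map ⟨g, hg.injective⟩)
    rwa [Finset.sum_map] at this
  have hfb : ∀ k, ε - δ ≤ ‖f k b‖ := fun k => by
    refine ge_of_tendsto (hb (f k)).norm ?_
    filter_upwards [eventually_gt_atTop k] with n hn
    rw [map_sum, ← Finset.add_sum_erase _ _ (Finset.mem_range.2 hn)]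
    have h1 := norm_sub_le_norm_add (f k (v (g k))) (∑ i ∈ (Finset.range n).erase k, f k (v (g i)))
    have h2 := (norm_sum_le _ _).trans (hfs k ((Finset.range n).erase k) (by simp))
    linarith [hfv k]
  obtain ⟨z, hz, hbz⟩ := exists_mem_span_norm_sub_lt (𝕜 := 𝕜) (w := fun i => v (g i))
    (fun n => Submodule.sum_mem _ fun i _ => Submodule.subset_span ⟨i, rfl⟩) hb
    (show 0 < ε / 4 by positivity)
  obtain ⟨a, rfl⟩ := (Finsupp.mem_span_range_iff_exists_finsupp).1 hz
  rw [Finsupp.sum] at hbz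
  obtain ⟨k, hk⟩ := Infinite.exists_notMem_finset a.support
  set z := ∑ i ∈ a.support, a i • v (g i)
  have hzC : ‖z‖ ≤ C + ε := by
    have := norm_sub_norm_le z b
    rw [norm_sub_rev] at this
    linarith
  have ha : ∀ i ∈ a.support, ‖a i‖ ≤ (C + ε) / (ε - δ) := fun i hi => by
    rw [le_div_iff₀' (by linarith)]
    exact (mul_norm_coeff_le_norm_sum (by linarith) hf hfv hfs a hi).trans hzC
  have hfz : ‖f k z‖ ≤ (C + ε) / (ε - δ) * δ := by
    calc ‖f k z‖ ≤ ∑ i ∈ a.support, (C + ε) / (ε - δ) * ‖f k (v (g i))‖ := by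
          rw [map_sum]
          refine (norm_sum_le _ _).trans (Finset.sum_le_sum fun i hi => ?_)
          rw [map_smul, smul_eq_mul, norm_mul]
          gcongr
          exact ha i hi
      _ ≤ _ := by
          rw [← Finset.mul_sum]
          have : 0 < ε - δ := by linarith
          gcongr
          exact hfs k _ hk
  have h1 : (C + ε) / (ε - δ) * δ ≤ ε / 8 := by
    have h : (C + ε) * δ = ε ^ 2 / 16 := by rw [hδ_def]; field_simp
    rw [div_mul_eq_mul_div, div_le_iff₀ (by linarith), h]
    nlinarith
  have h2 := norm_apply_le_of_norm_le_one (hf k) (b - z)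
  rw [map_sub] at h2
  have h3 := norm_sub_norm_le (f k b) (f k z)
  linarith [hfb k]

end BoundedSubsetSums

/-! ### The Loomis condition -/

section Loomis

variable {X : Type*} [NormedAddCommGroup X] {F : ℝ → X}

theorem norm_int_sub_le_mul {a : ℤ → X} {η : ℝ} {R : ℕ}
    (h : ∀ i : ℤ, -R ≤ i → i < R → ‖a (i + 1) - a i‖ ≤ η) {i : ℤ} (hi : i.natAbs ≤ R) :
    ‖a i - a 0‖ ≤ R * η := by
  have key : ∀ b : ℕ → X, (∀ k < R, ‖b (k + 1) - b k‖ ≤ η) → ∀ n ≤ R, ‖b n - b 0‖ ≤ n * η := by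
    intro b hb n
    induction n with
    | zero => simp
    | succ n ih =>
      intro hn
      have h1 := norm_add_le (b (n + 1) - b n) (b n - b 0)
      rw [sub_add_sub_cancel] at h1
      push_cast
      linarith [ih (by lia), hb n hn]
  have hle : (i.natAbs : ℝ) * η ≤ R * η := by
    rcases R.eq_zero_or_pos with rfl | hR
    · simp [Nat.le_zero.1 hi]
    · have hη : 0 ≤ η := (norm_nonneg _).trans (h 0 (by lia) (by lia))
      gcongr
  refine le_trans ?_ hle
  rcases i.natAbs_eq with hi' | hi'
  · have := key (fun k => a k) (fun k hk => by simpa using h k (by lia) (by lia)) _ hi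
    rwa [← hi'] at this
  · have := key (fun k => a (-k)) (fun k hk => by
      have := h (-(k + 1 : ℕ)) (by lia) (by lia)
      rw [norm_sub_rev]
      simpa using this) _ hi
    rw [← hi'] at this
    simpa using this

theorem exists_nat_forall_eq_int_div (P : Finset ℚ) :
    ∃ N R : ℕ, 0 < N ∧ ∀ q ∈ P, ∃ i : ℤ, i.natAbs ≤ R ∧ (q : ℝ) = i / N := by
  have hN : 0 < ∏ q ∈ P, q.den := Finset.prod_pos fun q _ => q.den_pos
  have h : ∀ q ∈ P, ∃ i : ℤ, (q : ℝ) = i / (∏ q ∈ P, q.den : ℕ) := fun q hq => by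
    obtain ⟨c, hc⟩ := Finset.dvd_prod_of_mem (fun q : ℚ => q.den) hq
    have hc0 : c ≠ 0 := by rintro rfl; simp [hc] at hN
    refine ⟨q.num * c, ?_⟩
    rw [hc, Rat.cast_def]
    push_cast
    rw [mul_div_mul_right _ _ (by exact_mod_cast hc0)]
  choose! i hi using h
  exact ⟨_, P.sup fun q => (i q).natAbs, hN, fun q hq =>
    ⟨i q, Finset.le_sup (f := fun q => (i q).natAbs) hq, hi q hq⟩⟩

/-- If `F` is not recurrent although its differences are, then the increments
`F (t + q) - F t` of `F` under certain rational translations `q` stay away from `0` at some point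
`t₀` and are nearly constant on any prescribed finite subset of `t₀ + ℚ`. Only the differences
with step `1 / N` enter: since the increments along `ℤ / N` telescope, one recurrent function
controls all of them. By continuity of `F` the translation can be taken rational. -/
theorem exists_rat_translation_of_notMem_recDiscrete (hF : Continuous F)
    (hΔ : ∀ h : ℝ, 0 < h → differenceFun h F ∈ recDiscrete X) (hrec : F ∉ recDiscrete X) :
    ∃ (t₀ ε : ℝ), 0 < ε ∧ ∀ (P : Finset ℚ) (η : ℝ), 0 < η → ∃ q : ℚ, ε < ‖F (t₀ + q) - F t₀‖ ∧
      ∀ r ∈ P, ‖F (t₀ + r + q) - F (t₀ + r) - (F (t₀ + q) - F t₀)‖ < η := by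
  classical
  rw [mem_recDiscrete_iff, not_and] at hrec
  have hrec := hrec hF
  push Not at hrec
  obtain ⟨K, ε, hε, hK⟩ := hrec
  by_contra! hcon
  choose P η hη hP using fun t => hcon t ε hε
  -- a single finite set of rationals and a single tolerance for all points of `K`
  obtain ⟨N, R, hN, hNR⟩ := exists_nat_forall_eq_int_div (K.biUnion P)
  obtain ⟨δ, hδ, hδη⟩ : ∃ δ : ℝ, 0 < δ ∧ ∀ t ∈ K, δ < η t := by
    rcases K.eq_empty_or_nonempty with rfl | hne
    · exact ⟨1, one_pos, by simp⟩
    · obtain ⟨t, -, ht⟩ := K.exists_min_image η hne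
      exact ⟨η t / 2, half_pos (hη t), fun s hs => (half_lt_self (hη t)).trans_le (ht s hs)⟩
  have hN' : (0 : ℝ) < N := by exact_mod_cast hN
  set K' : Finset ℝ := K.biUnion fun t =>
    (Finset.Ico (-R : ℤ) R).image fun i : ℤ => t + (i : ℝ) / N with hK'
  have hdense := (mem_recDiscrete_iff.1 (hΔ (1 / N) (by positivity))).2 K' (δ / (R + 1))
    (by positivity)
  have hex : ∃ τ : ℝ, (∀ t ∈ K', ‖differenceFun (1 / N) F (t + τ) - differenceFun (1 / N) F t‖ ≤
      δ / (R + 1)) ∧ ∃ t ∈ K, ε < ‖F (t + τ) - F t‖ := by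
    by_contra! h
    exact hK (hdense.mono fun τ hτ => h _ hτ)
  obtain ⟨τ, hτ, t, ht, hετ⟩ := hex
  have hconst : ∀ r ∈ P t, ‖F (t + r + τ) - F (t + r) - (F (t + τ) - F t)‖ < η t := by
    intro r hr
    obtain ⟨i, hi, hri⟩ := hNR r (Finset.mem_biUnion.2 ⟨t, ht, hr⟩)
    have h1 := norm_int_sub_le_mul
      (a := fun i : ℤ => F (t + (i : ℝ) / N + τ) - F (t + (i : ℝ) / N))
      (η := δ / (R + 1)) (R := R) (fun j hj hj' => by
        have := hτ (t + (j : ℝ) / N) (Finset.mem_biUnion.2 ⟨t, ht, Finset.mem_image.2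
          ⟨j, Finset.mem_Ico.2 ⟨hj, hj'⟩, rfl⟩⟩)
        simp only [differenceFun] at this
        convert this using 2
        push_cast
        rw [show t + ((j : ℝ) + 1) / N + τ = t + (j : ℝ) / N + τ + 1 / N by ring,
          show t + ((j : ℝ) + 1) / N = t + (j : ℝ) / N + 1 / N by ring]
        abel) hi
    simp only [Int.cast_zero, zero_div, add_zero, ← hri] at h1
    refine h1.trans_lt (lt_of_le_of_lt ?_ (hδη t ht))
    rw [mul_div_assoc', div_le_iff₀ (by positivity)]
    nlinarith
  have hopen : IsOpen {σ : ℝ | ε < ‖F (t + σ) - F t‖ ∧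
      ∀ r ∈ P t, ‖F (t + r + σ) - F (t + r) - (F (t + σ) - F t)‖ < η t} := by
    have : {σ : ℝ | ε < ‖F (t + σ) - F t‖ ∧
        ∀ r ∈ P t, ‖F (t + r + σ) - F (t + r) - (F (t + σ) - F t)‖ < η t} =
        {σ : ℝ | ε < ‖F (t + σ) - F t‖} ∩
        ⋂ r ∈ P t, {σ : ℝ | ‖F (t + r + σ) - F (t + r) - (F (t + σ) - F t)‖ < η t} := by
      ext; simp
    rw [this]
    exact (isOpen_lt (by fun_prop) (by fun_prop)).inter
      (isOpen_biInter_finset fun r _ => isOpen_lt (by fun_prop) (by fun_prop))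
  obtain ⟨q, hq, hq'⟩ := (Rat.denseRange_cast (𝕜 := ℝ)).exists_mem_open hopen ⟨τ, hετ, hconst⟩
  obtain ⟨r, hr, hr'⟩ := hP t q hq
  exact (hq' r hr).not_ge hr'

/-- Iterating `exists_rat_translation_of_notMem_recDiscrete` along the finite sums of the previous
translations yields increments that add up, with summable errors:
`F (t₀ + ∑ σ i) ≈ F t₀ + ∑ v i`. -/
theorem exists_additive_increments {t₀ ε : ℝ}
    (h : ∀ (P : Finset ℚ) (η : ℝ), 0 < η → ∃ q : ℚ, ε < ‖F (t₀ + q) - F t₀‖ ∧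
      ∀ r ∈ P, ‖F (t₀ + r + q) - F (t₀ + r) - (F (t₀ + q) - F t₀)‖ < η) :
    ∃ (σ : ℕ → ℝ) (v : ℕ → X), (∀ n, ε ≤ ‖v n‖) ∧ ∀ n, ∀ S : Finset ℕ, (∀ i ∈ S, i < n) →
      ‖F (t₀ + ∑ i ∈ S, σ i + σ n) - F (t₀ + ∑ i ∈ S, σ i) - v n‖ ≤ (1 / 2) ^ n := by
  classical
  choose q hqε hq using fun (P : Finset ℚ) (n : ℕ) => h P ((1 / 2) ^ n) (by positivity)
  -- `P n` contains all sums of distinct translations chosen before step `n`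
  let P : ℕ → Finset ℚ := fun n => Nat.rec {0} (fun n P => P ∪ P.image (· + q P n)) n
  have hP : ∀ n, P (n + 1) = P n ∪ (P n).image (· + q (P n) n) := fun _ => rfl
  have hPS : ∀ n, ∀ S : Finset ℕ, (∀ i ∈ S, i < n) → ∑ i ∈ S, q (P i) i ∈ P n := by
    intro n
    induction n with
    | zero =>
      intro S hS
      rw [Finset.eq_empty_of_forall_notMem fun i hi => (Nat.not_lt_zero i) (hS i hi)]
      simp [P]
    | succ n ih =>
      intro S hS
      rw [hP]
      by_cases hn : n ∈ S
      · rw [← Finset.sum_erase_add S _ hn]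
        exact Finset.mem_union_right _ (Finset.mem_image_of_mem _ (ih _ fun i hi => by
          have h1 := hS i (Finset.mem_of_mem_erase hi)
          have h2 := Finset.ne_of_mem_erase hi
          lia))
      · refine Finset.mem_union_left _ (ih S fun i hi => ?_)
        have h1 := hS i hi
        have h2 : i ≠ n := fun h => hn (h ▸ hi)
        lia
  refine ⟨fun n => q (P n) n, fun n => F (t₀ + q (P n) n) - F t₀, fun n => (hqε _ _).le,
    fun n S hS => ?_⟩
  simpa using (hq (P n) n _ (hPS n S hS)).le

theorem norm_increment_sub_sum_le {t₀ : ℝ} {σ : ℕ → ℝ} {v : ℕ → X}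
    (h : ∀ n, ∀ S : Finset ℕ, (∀ i ∈ S, i < n) →
      ‖F (t₀ + ∑ i ∈ S, σ i + σ n) - F (t₀ + ∑ i ∈ S, σ i) - v n‖ ≤ (1 / 2) ^ n) (S : Finset ℕ) :
    ‖F (t₀ + ∑ i ∈ S, σ i) - F t₀ - ∑ i ∈ S, v i‖ ≤ ∑ i ∈ S, (1 / 2 : ℝ) ^ i := by
  induction S using Finset.induction_on_max with
  | empty => simp
  | insert n S hS ih =>
    have hn : n ∉ S := fun hn => lt_irrefl n (hS n hn)
    rw [Finset.sum_insert hn, Finset.sum_insert hn, Finset.sum_insert hn, add_comm (σ n),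
      ← add_assoc]
    refine le_trans ?_ (add_le_add (h n S hS) ih)
    refine le_trans (le_of_eq ?_) (norm_add_le _ _)
    congr 1
    abel

theorem norm_sum_increments_le {t₀ C : ℝ} {σ : ℕ → ℝ} {v : ℕ → X} (hC : ∀ t, ‖F t‖ ≤ C)
    (h : ∀ n, ∀ S : Finset ℕ, (∀ i ∈ S, i < n) →
      ‖F (t₀ + ∑ i ∈ S, σ i + σ n) - F (t₀ + ∑ i ∈ S, σ i) - v n‖ ≤ (1 / 2) ^ n) (S : Finset ℕ) :
    ‖∑ i ∈ S, v i‖ ≤ 2 * C + 2 := by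
  have h1 := norm_increment_sub_sum_le h S
  have h2 : ∑ i ∈ S, (1 / 2 : ℝ) ^ i ≤ 2 :=
    (summable_geometric_two.sum_le_tsum _ fun _ _ => by positivity).trans_eq tsum_geometric_two
  have h3 := norm_le_norm_add_norm_sub (F (t₀ + ∑ i ∈ S, σ i) - F t₀) (∑ i ∈ S, v i)
  have h4 := norm_sub_le (F (t₀ + ∑ i ∈ S, σ i)) (F t₀)
  linarith [hC (t₀ + ∑ i ∈ S, σ i), hC t₀]

theorem satisfiesL_recDiscrete_boundedCont (𝕜 : Type*) [RCLike 𝕜] [NormedSpace 𝕜 X]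
    [CompleteSpace X] (hX : ¬ ContainsC0 𝕜 X) : SatisfiesL (recDiscrete X) (boundedCont X) := by
  rintro F ⟨hF, C, hC⟩ hΔ
  by_contra hrec
  obtain ⟨t₀, ε, hε, h⟩ := exists_rat_translation_of_notMem_recDiscrete hF hΔ hrec
  obtain ⟨σ, v, hv, hσ⟩ := exists_additive_increments h
  exact hX (containsC0_of_norm_sum_le 𝕜 (norm_sum_increments_le hC hσ) hε hv)

/-- The values of `F` at the partial sums of the translations differ from the partial sums of the
increments by a norm convergent sequence, so that weak convergence carries over from the former
to the latter. -/
theorem satisfiesL_recDiscrete_boundedContWscp (𝕜 : Type*) [RCLike 𝕜] [NormedSpace 𝕜 X]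
    [CompleteSpace X] : SatisfiesL (recDiscrete X) (boundedContWscp 𝕜 X) := by
  rintro F ⟨⟨hF, C, hC⟩, hwscp⟩ hΔ
  by_contra hrec
  obtain ⟨t₀, ε, hε, h⟩ := exists_rat_translation_of_notMem_recDiscrete hF hΔ hrec
  obtain ⟨σ, v, hv, hσ⟩ := exists_additive_increments h
  have hvC := norm_sum_increments_le hC hσ
  obtain ⟨g, hg, hlim⟩ := exists_subseq_not_weakly_convergent 𝕜 hvC hε hv
  refine hlim ?_
  set x : ℕ → X := fun n => F (t₀ + ∑ i ∈ Finset.range n, σ (g i))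
  set y : ℕ → X := fun n => ∑ i ∈ Finset.range n, v (g i)
  have hmap : ∀ (n : ℕ) (w : ℕ → ℝ), ∑ i ∈ Finset.range n, w (g i) =
      ∑ j ∈ (Finset.range n).map ⟨g, hg.injective⟩, w j := fun n w => by simp
  have herr : CauchySeq fun n => x n - y n := by
    refine cauchySeq_of_le_geometric (1 / 2) 1 (by norm_num) fun n => ?_
    rw [dist_comm, dist_eq_norm, one_mul]
    have h1 := hσ (g n) ((Finset.range n).map ⟨g, hg.injective⟩) fun j hj => by
      obtain ⟨i, hi, rfl⟩ := Finset.mem_map.1 hj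
      exact hg (Finset.mem_range.1 hi)
    rw [← hmap] at h1
    have h2 : x (n + 1) - y (n + 1) - (x n - y n) =
        F (t₀ + ∑ i ∈ Finset.range n, σ (g i) + σ (g n)) -
          F (t₀ + ∑ i ∈ Finset.range n, σ (g i)) - v (g n) := by
      simp only [x, y, Finset.sum_range_succ, ← add_assoc]
      abel
    rw [h2]
    exact h1.trans (pow_le_pow_of_le_one (by norm_num) (by norm_num) hg.le_apply)
  obtain ⟨e, he⟩ := cauchySeq_tendsto_of_complete herr
  have hy : ∀ φ : X →L[𝕜] 𝕜, CauchySeq fun n => φ (y n) := fun φ => by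
    have hsum : Summable fun i => ‖φ (v (g i))‖ :=
      summable_of_sum_le (fun _ => norm_nonneg _) (sum_norm_le_of_norm_sum_le
        (C := ‖φ‖ * (2 * C + 2)) fun S => by
          rw [← map_sum]
          refine (φ.le_opNorm _).trans ?_
          gcongr
          have := hvC (S.map ⟨g, hg.injective⟩)
          rwa [Finset.sum_map] at this)
    have := hsum.of_norm.hasSum.tendsto_sum_nat.cauchySeq
    simpa only [y, map_sum] using this
  obtain ⟨a, ha⟩ := hwscp x (fun n => mem_range_self _) fun φ => by
    have := (hy φ).add (he.cauchySeq.map φ.uniformContinuous)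
    convert this using 2 with n
    simp
  refine ⟨a - e, fun φ => ?_⟩
  have := (ha φ).sub ((φ.continuous.tendsto e).comp he)
  rw [← map_sub] at this
  refine this.congr fun n => ?_
  simp [y]

/-- In `ℂ` weakly Cauchy sequences are Cauchy. -/
theorem boundedCont_subset_boundedContWscp : boundedCont ℂ ⊆ boundedContWscp ℂ ℂ :=
  fun _ hf => ⟨hf, fun x _ hx => by
    obtain ⟨a, ha⟩ := cauchySeq_tendsto_of_complete (hx (ContinuousLinearMap.id ℂ ℂ))
    exact ⟨a, fun φ => (φ.continuous.tendsto a).comp ha⟩⟩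

end Loomis

/-! ### Comparison with minimal functions and the main result -/

theorem recDiscrete_subset_minDiscrete {X : Type*} [NormedAddCommGroup X] :
    recDiscrete X ⊆ minDiscrete X :=
  fun _ hf => ⟨REC_subset_MIN hf.1, hf.2⟩

theorem recDiscrete_inter_boundedCont {X : Type*} [NormedAddCommGroup X] [ProperSpace X] :
    recDiscrete X ∩ boundedCont X = minDiscrete X ∩ boundedCont X := by
  refine Subset.antisymm (inter_subset_inter_left _ recDiscrete_subset_minDiscrete) ?_
  rintro f ⟨hf, hfc, C, hC⟩
  exact ⟨⟨mem_REC_of_mem_MIN_of_bounded hf.1 fun t => hC _, hfc⟩, hfc, C, hC⟩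

theorem not_satisfiesP_recDiscrete_boundedCont :
    ¬ SatisfiesP (recDiscrete ℂ) (boundedCont ℂ) :=
  fun h => indefIntegral_quadraticPhase_notMem_recDiscrete
    (h _ quadraticPhase_mem_recDiscrete continuous_quadraticPhase.locallyIntegrable
      indefIntegral_quadraticPhase_mem_boundedCont)

theorem mainTheorem12 :
    -- (a) the Loomis condition, in the two cases for `U` and `X`
    (∀ (𝕜 : Type*) [RCLike 𝕜] (X : Type*) [NormedAddCommGroup X] [NormedSpace 𝕜 X]
        [CompleteSpace X],
      (¬ ContainsC0 𝕜 X → SatisfiesL (recDiscrete X) (boundedCont X)) ∧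
      SatisfiesL (recDiscrete X) (boundedContWscp 𝕜 X)) ∧
    -- (b) failure of the integration condition for `X = ℂ` and `U = C_b`, with its witness
    (quadraticPhase ∈ recDiscrete ℂ ∧
      indefIntegral quadraticPhase ∈ boundedCont ℂ ∧
      indefIntegral quadraticPhase ∉ recDiscrete ℂ) ∧
    ¬ SatisfiesP (recDiscrete ℂ) (boundedCont ℂ) ∧
    -- comparison with minimal functions
    recDiscrete ℂ ⊆ minDiscrete ℂ ∧
    recDiscrete ℂ ∩ boundedCont ℂ = minDiscrete ℂ ∩ boundedCont ℂ ∧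
    -- (c) the inclusion in the mean class fails, also for the bounded part
    ¬ (recDiscrete ℂ ⊆ meanClass (recDiscrete ℂ)) ∧
    ¬ (recDiscrete ℂ ∩ boundedCont ℂ ⊆ meanClass (recDiscrete ℂ ∩ boundedCont ℂ)) ∧
    -- hence, for `X = ℂ` and `U = C_b`, the Loomis condition holds but the integration one does not
    (SatisfiesL (recDiscrete ℂ) (boundedCont ℂ) ∧
      ¬ SatisfiesP (recDiscrete ℂ) (boundedCont ℂ)) := by
  refine ⟨fun 𝕜 _ X _ _ _ => ⟨satisfiesL_recDiscrete_boundedCont 𝕜,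
      satisfiesL_recDiscrete_boundedContWscp 𝕜⟩,
    ⟨quadraticPhase_mem_recDiscrete, indefIntegral_quadraticPhase_mem_boundedCont,
      indefIntegral_quadraticPhase_notMem_recDiscrete⟩,
    not_satisfiesP_recDiscrete_boundedCont, recDiscrete_subset_minDiscrete,
    recDiscrete_inter_boundedCont,
    fun h => meanFun_one_quadraticPhase_notMem_recDiscrete
      ((h quadraticPhase_mem_recDiscrete).2 1 one_pos),
    fun h => meanFun_one_quadraticPhase_notMem_recDiscrete
      ((h ⟨quadraticPhase_mem_recDiscrete, quadraticPhase_mem_boundedCont⟩).2 1 one_pos).1,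
    fun F hF => satisfiesL_recDiscrete_boundedContWscp ℂ F (boundedCont_subset_boundedContWscp hF),
    not_satisfiesP_recDiscrete_boundedCont⟩
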